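/- The halved $10$-cube is the graph whose vertices are the binary words of length $10$ with an even number of ones, two words being adjacent if and only if they differ in exactly two positions. An equitable $2$-partition of a graph with quotient matrix $\begin{pmatrix} a & b\\ c & d\end{pmatrix}$ is an ordered partition $(C_0,C_1)$ of the vertex set into two nonempty cells such that every vertex of $C_0$ has exactly $a$ neighbours in $C_0$ and $b$ neighbours in $C_1$, and every vertex of $C_1$ has exactly $c$ neighbours in $C_0$ and $d$ neighbours in $C_1$. **Theorem.** For every $a\in\{14,15,\ldots,28\}\setminus\{21\}$ and all nonnegative integers $b,c,d$ such that $13$ is an eigenvalue of the matrix $\begin{pmatrix} a & b\\ c & d\end{pmatrix}$, the halved $10$-cube has no equitable $2$-partition with quotient matrix $\begin{pmatrix} a & b\\ c & d\end{pmatrix}$. -/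

import Mathlib

/-- The halved `n`-cube: the vertices are the binary words of length `n` with an even number of
ones, two of them being adjacent iff they differ in exactly two positions. -/
def halvedCube (n : ℕ) : SimpleGraph {x : Fin n → ZMod 2 // Even (hammingNorm x)} where
  Adj x y := hammingDist x.1 y.1 = 2
  symm := ⟨fun x y h => by rw [hammingDist_comm]; exact h⟩
  loopless := ⟨fun x h => by simp at h⟩

/-- The ordered partition of the vertex set with the cells `C i = {v | C v = i}`, `i < k`,
(all nonempty) is an equitable `k`-partition of the finite graph `G` with quotient matrix `S`:
every vertex of the cell `i` has exactly `S i j` neighbours in the cell `j`. -/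
def IsEquitablePartition {V : Type*} [Finite V] (G : SimpleGraph V) {k : ℕ} (C : V → Fin k)
    (S : Matrix (Fin k) (Fin k) ℕ) : Prop :=
  Function.Surjective C ∧
    ∀ i j : Fin k, ∀ v : V, C v = i → {w : V | G.Adj v w ∧ C w = j}.ncard = S i j

open scoped symmDiff

set_option linter.unusedSectionVars false

/-! ### Walsh characters of the binary cube. -/

section Walsh

variable {ι : Type*} [Fintype ι] [DecidableEq ι]

/-! Walsh functions diagonalise the halved cube, with eigenvalue `13` exactly at degrees `2` and
`8`, which agree on even words. Since rows sum to `45` and `13` is an eigenvalue, `a = c + 13`.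
Hence on even words the indicator of `C₀` is `F = c/32 + Q`, with `Q` a combination of Walsh
functions of degree `2`.

The key is to leave the even words: `F² - F` has degree at most `4` and vanishes on them, so it
vanishes everywhere (`eq_zero_of_eq_zero_on_even`). Now `F` is Boolean on the whole cube, so its
second differences make `4c/32` an integer (`exists_int_eq_four_mul_mean`). Thus `8 ∣ c`, while `c =
a - 13` lies in `{1, …, 15} \ {8}`. -/

/-- The nontrivial real character of `ZMod 2`. -/
noncomputable def binarySign (z : ZMod 2) : ℝ := if z = 0 then 1 else -1

theorem binarySign_add (y z : ZMod 2) : binarySign (y + z) = binarySign y * binarySign z := by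
  have h : ∀ z : ZMod 2, z = 0 ∨ z = 1 := by decide
  have h2 : (1 : ZMod 2) + 1 = 0 := rfl
  rcases h y with rfl | rfl <;> rcases h z with rfl | rfl <;> simp [binarySign, h2]

theorem binarySign_mul_self (z : ZMod 2) : binarySign z * binarySign z = 1 := by
  unfold binarySign; split_ifs <;> norm_num

/-- The Walsh function (real character) of `ι → ZMod 2` indexed by the set `S`. -/
noncomputable def walsh (S : Finset ι) (v : ι → ZMod 2) : ℝ := ∏ i ∈ S, binarySign (v i)

theorem walsh_empty (v : ι → ZMod 2) : walsh ∅ v = 1 := by simp [walsh]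

theorem walsh_zero (S : Finset ι) : walsh S (0 : ι → ZMod 2) = 1 := by simp [walsh, binarySign]

theorem walsh_add (S : Finset ι) (v w : ι → ZMod 2) :
    walsh S (v + w) = walsh S v * walsh S w := by
  simp [walsh, binarySign_add, Finset.prod_mul_distrib]

theorem walsh_mul (S T : Finset ι) (v : ι → ZMod 2) :
    walsh S v * walsh T v = walsh (S ∆ T) v := by
  have h : ∀ U : Finset ι, walsh U v = ∏ i, if i ∈ U then binarySign (v i) else 1 := by
    intro U; simp [walsh]
  rw [h, h, h, ← Finset.prod_mul_distrib]
  refine Finset.prod_congr rfl fun i _ => ?_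
  by_cases hS : i ∈ S <;> by_cases hT : i ∈ T <;>
    simp [Finset.mem_symmDiff, hS, hT, binarySign_mul_self]

theorem walsh_single (S : Finset ι) (i : ι) :
    walsh S (Pi.single i 1) = if i ∈ S then -1 else 1 := by
  rw [walsh, ← Finset.prod_ite_eq' S i (fun _ => (-1 : ℝ))]
  refine Finset.prod_congr rfl fun j _ => ?_
  by_cases h : j = i
  · subst h; simp [binarySign]
  · simp [binarySign, h]

theorem sum_walsh_eq_zero {S : Finset ι} (hS : S.Nonempty) : ∑ v, walsh S v = 0 := by
  obtain ⟨i, hi⟩ := hS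
  have h := Equiv.sum_comp (Equiv.addRight (Pi.single i 1 : ι → ZMod 2)) (walsh S)
  simp only [Equiv.coe_addRight, walsh_add, walsh_single, hi, if_true, mul_neg, mul_one,
    Finset.sum_neg_distrib] at h
  linarith

theorem sum_index_walsh (v : ι → ZMod 2) :
    ∑ S, walsh S v = if v = 0 then 2 ^ Fintype.card ι else 0 := by
  have h : ∑ S, walsh S v = ∏ i, (1 + binarySign (v i)) := by
    rw [Finset.prod_one_add, Finset.powerset_univ]; rfl
  rw [h]
  split_ifs with hv
  · subst hv; norm_num [binarySign]
  · obtain ⟨i, hi⟩ := Function.ne_iff.mp hv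
    exact Finset.prod_eq_zero (Finset.mem_univ i) (by simp_all [binarySign])

theorem walsh_univ (v : ι → ZMod 2) : walsh Finset.univ v = (-1) ^ hammingNorm v := by
  simp [walsh, binarySign, Finset.prod_ite, hammingNorm]

theorem walsh_compl (S : Finset ι) (v : ι → ZMod 2) :
    walsh Sᶜ v = walsh Finset.univ v * walsh S v := by
  rw [walsh_mul]; congr 1; ext i; simp [Finset.mem_symmDiff]

/-! ### Walsh transform and even words. -/

/-- The Walsh transform. -/
noncomputable def walshTransform (g : (ι → ZMod 2) → ℝ) (S : Finset ι) : ℝ :=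
  ∑ v, g v * walsh S v

theorem add_self_binary (v : ι → ZMod 2) : v + v = 0 := by
  ext i; exact CharTwo.add_self_eq_zero _

theorem walsh_inversion (g : (ι → ZMod 2) → ℝ) (v : ι → ZMod 2) :
    ∑ S, walshTransform g S * walsh S v = 2 ^ Fintype.card ι * g v := by
  have h : ∀ S, walshTransform g S * walsh S v = ∑ w, g w * walsh S (w + v) := by
    intro S
    simp only [walshTransform, Finset.sum_mul, walsh_add, mul_assoc]
  simp only [h]
  rw [Finset.sum_comm]
  simp only [← Finset.mul_sum, sum_index_walsh]
  rw [Finset.sum_eq_single v]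
  · simp [add_self_binary, mul_comm]
  · intro w _ hw
    rw [if_neg, mul_zero]
    intro h0
    apply hw
    have := congrArg (· + v) h0
    simpa [add_assoc, add_self_binary] using this
  · simp

theorem walshTransform_sum_translate (g : (ι → ZMod 2) → ℝ) (D : Finset (ι → ZMod 2))
    (S : Finset ι) :
    walshTransform (fun v => ∑ d ∈ D, g (v + d)) S = (∑ d ∈ D, walsh S d) * walshTransform g S := by
  simp only [walshTransform, Finset.sum_mul]
  rw [Finset.sum_comm]
  refine Finset.sum_congr rfl fun d _ => ?_
  rw [← Equiv.sum_comp (Equiv.addRight d), Finset.mul_sum]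
  refine Finset.sum_congr rfl fun v _ => ?_
  simp only [Equiv.coe_addRight, add_assoc, add_self_binary, add_zero, walsh_add]
  ring

theorem walshTransform_compl {g : (ι → ZMod 2) → ℝ}
    (hg : ∀ v, ¬ Even (hammingNorm v) → g v = 0) (S : Finset ι) :
    walshTransform g Sᶜ = walshTransform g S := by
  refine Finset.sum_congr rfl fun v _ => ?_
  by_cases hv : Even (hammingNorm v)
  · rw [walsh_compl, walsh_univ, hv.neg_one_pow, one_mul]
  · simp [hg v hv]

theorem sum_even_walsh_eq_zero {S : Finset ι} (h0 : S ≠ ∅) (h1 : S ≠ Finset.univ) :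
    walshTransform (fun v => if Even (hammingNorm v) then 1 else 0) S = 0 := by
  have h : ∀ v, (if Even (hammingNorm v) then 1 else 0) * walsh S v
      = (walsh S v + walsh Sᶜ v) / 2 := by
    intro v
    rw [walsh_compl, walsh_univ]
    split_ifs with hv
    · rw [hv.neg_one_pow]; ring
    · rw [(Nat.not_even_iff_odd.mp hv).neg_one_pow]; ring
  simp only [walshTransform, h]
  rw [← Finset.sum_div, Finset.sum_add_distrib,
    sum_walsh_eq_zero (Finset.nonempty_iff_ne_empty.mpr h0),
    sum_walsh_eq_zero (Finset.nonempty_iff_ne_empty.mpr (by simpa using h1))]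
  simp

theorem sum_even_walsh_empty [Nonempty ι] :
    walshTransform (fun v : ι → ZMod 2 => if Even (hammingNorm v) then 1 else 0) ∅
      = 2 ^ Fintype.card ι / 2 := by
  have h : ∀ v : ι → ZMod 2, (if Even (hammingNorm v) then (1 : ℝ) else 0) * walsh ∅ v
      = (1 + walsh Finset.univ v) / 2 := by
    intro v
    rw [walsh_empty, walsh_univ]
    split_ifs with hv
    · rw [hv.neg_one_pow]; ring
    · rw [(Nat.not_even_iff_odd.mp hv).neg_one_pow]; ring
  simp only [walshTransform, h]
  rw [← Finset.sum_div, Finset.sum_add_distrib, sum_walsh_eq_zero Finset.univ_nonempty]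
  simp

/-- The number of words of weight two, weighted by a Walsh function. -/
theorem sum_walsh_weight_two (S : Finset ι) :
    ∑ d : ι → ZMod 2 with hammingNorm d = 2, walsh S d
      = ((Fintype.card ι - 2 * S.card : ℝ) ^ 2 - Fintype.card ι) / 2 := by
  set x : ι → ℝ := fun i => if i ∈ S then -1 else 1 with hx
  have h1 : ∑ d : ι → ZMod 2 with hammingNorm d = 2, walsh S d
      = ∑ t ∈ Finset.powersetCard 2 (Finset.univ : Finset ι), ∏ i ∈ t, x i := by
    refine Finset.sum_bij' (fun d _ => Finset.univ.filter fun i => d i ≠ 0)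
      (fun t _ i => if i ∈ t then 1 else 0) ?_ ?_ ?_ ?_ ?_
    · intro d hd
      simpa [hammingNorm, Finset.mem_powersetCard] using hd
    · intro t ht
      simpa [hammingNorm, Finset.mem_powersetCard] using ht
    · intro d _
      ext i
      have : ∀ z : ZMod 2, (if z ≠ 0 then (1 : ZMod 2) else 0) = z := by decide
      simpa using this (d i)
    · intro t _
      ext i
      simp
    · intro d _
      simp [walsh, binarySign, hx, Finset.prod_ite, Finset.prod_const]
      congr 2
      ext i; simp [and_comm]
  -- Newton's identity `2e₂ = e₁p₁ - p₂` at the signs `x`.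
  have h2 := congrArg (MvPolynomial.aeval x) (MvPolynomial.mul_esymm_eq_sum ι ℝ 2)
  have h3 : ∑ i, x i = Fintype.card ι - 2 * S.card := by
    have : ∀ i, x i = 1 - 2 * (if i ∈ S then 1 else 0) := by
      intro i; simp only [hx]; split_ifs <;> norm_num
    simp [this, mul_comm]
  have h4 : ∑ i, x i ^ 2 = Fintype.card ι := by
    have : ∀ i, x i ^ 2 = 1 := by
      intro i; simp only [hx]; split_ifs <;> norm_num
    simp [this]
  rw [show (Finset.filter (fun a : ℕ × ℕ => a.1 < 2) (Finset.HasAntidiagonal.antidiagonal 2))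
    = {(0, 2), (1, 1)} by decide] at h2
  simp [MvPolynomial.esymm, MvPolynomial.psum, Finset.powersetCard_one, h3, h4] at h2
  rw [h1]
  linarith

/-! ### Functions of low degree. -/

/-- Functions on the cube that are combinations of Walsh functions of degree at most `d`. -/
def walshDegreeLE (ι : Type*) [Fintype ι] [DecidableEq ι] (d : ℕ) :
    Submodule ℝ ((ι → ZMod 2) → ℝ) :=
  Submodule.span ℝ (walsh '' {S : Finset ι | S.card ≤ d})

theorem walsh_mem_walshDegreeLE {S : Finset ι} {d : ℕ} (h : S.card ≤ d) :
    walsh S ∈ walshDegreeLE ι d :=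
  Submodule.subset_span ⟨S, h, rfl⟩

theorem walshDegreeLE_mono {d e : ℕ} (h : d ≤ e) : walshDegreeLE ι d ≤ walshDegreeLE ι e :=
  Submodule.span_mono (Set.image_mono fun _ hS => le_trans hS h)

theorem mul_mem_walshDegreeLE {d e : ℕ} {f g : (ι → ZMod 2) → ℝ} (hf : f ∈ walshDegreeLE ι d)
    (hg : g ∈ walshDegreeLE ι e) : f * g ∈ walshDegreeLE ι (d + e) := by
  have h : walshDegreeLE ι d * walshDegreeLE ι e ≤ walshDegreeLE ι (d + e) := by
    rw [walshDegreeLE, walshDegreeLE, Submodule.span_mul_span, Submodule.span_le]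
    rintro _ ⟨_, ⟨S, hS, rfl⟩, _, ⟨T, hT, rfl⟩, rfl⟩
    have hST : walsh S * walsh T = walsh (S ∆ T) := funext (walsh_mul S T)
    show walsh S * walsh T ∈ walshDegreeLE ι (d + e)
    rw [hST]
    refine walsh_mem_walshDegreeLE ?_
    calc (S ∆ T).card ≤ (S ∪ T).card := Finset.card_le_card (by
          intro i; simp only [Finset.mem_symmDiff, Finset.mem_union]; tauto)
      _ ≤ S.card + T.card := Finset.card_union_le S T
      _ ≤ d + e := add_le_add hS hT
  exact h (Submodule.mul_mem_mul hf hg)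

theorem sum_walsh_univ_mul_eq_zero {d : ℕ} (hd : d < Fintype.card ι) {f : (ι → ZMod 2) → ℝ}
    (hf : f ∈ walshDegreeLE ι d) : ∑ v, walsh Finset.univ v * f v = 0 := by
  induction hf using Submodule.span_induction with
  | mem f hf =>
    obtain ⟨S, hS, rfl⟩ := hf
    simp only [← walsh_compl]
    refine sum_walsh_eq_zero ?_
    rw [← Finset.card_pos, Finset.card_compl]
    have : S.card ≤ d := hS
    omega
  | zero => simp
  | add f g _ _ hf hg => simp [mul_add, Finset.sum_add_distrib, hf, hg]
  | smul r f _ hf =>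
    have h : ∀ v, walsh Finset.univ v * (r • f) v = r * (walsh Finset.univ v * f v) := by
      intro v; simp only [Pi.smul_apply, smul_eq_mul]; ring
    simp only [h, ← Finset.mul_sum, hf, mul_zero]

/-- A function of low degree that vanishes on the even words vanishes on all words. -/
theorem eq_zero_of_eq_zero_on_even {d : ℕ} (hd : d + d < Fintype.card ι)
    {f : (ι → ZMod 2) → ℝ} (hf : f ∈ walshDegreeLE ι d)
    (h0 : ∀ v, Even (hammingNorm v) → f v = 0) (v : ι → ZMod 2) : f v = 0 := by
  -- `f²` is orthogonal to the parity character, so it has equal sums over even and odd words; both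
  -- are zero.
  have h := sum_walsh_univ_mul_eq_zero hd (mul_mem_walshDegreeLE hf hf)
  have h' : ∀ v, walsh Finset.univ v * (f * f) v = -(f v * f v) := by
    intro v
    rw [walsh_univ, Pi.mul_apply]
    by_cases hv : Even (hammingNorm v)
    · simp [h0 v hv]
    · rw [(Nat.not_even_iff_odd.mp hv).neg_one_pow]; ring
  simp only [h', Finset.sum_neg_distrib, neg_eq_zero] at h
  rw [Finset.sum_eq_zero_iff_of_nonneg fun v _ => mul_self_nonneg _] at h
  simpa using h v (Finset.mem_univ v)

/-- The mean of a Boolean function on the even words whose nonconstant part is a quadratic form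
is a multiple of `1 / 4`. -/
theorem exists_int_eq_four_mul_mean (hcard : 8 < Fintype.card ι) (t : ℝ) (α : Finset ι → ℝ)
    (h : ∀ v : ι → ZMod 2, Even (hammingNorm v) →
      t + ∑ S ∈ Finset.powersetCard 2 Finset.univ, α S * walsh S v = 0 ∨
      t + ∑ S ∈ Finset.powersetCard 2 Finset.univ, α S * walsh S v = 1) :
    ∃ m : ℤ, 4 * t = m := by
  obtain ⟨F, hF⟩ : ∃ F : (ι → ZMod 2) → ℝ, F =
    fun v => t + ∑ S ∈ Finset.powersetCard 2 Finset.univ, α S * walsh S v := ⟨_, rfl⟩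
  have hdeg : F ∈ walshDegreeLE ι 2 := by
    have : F = t • walsh ∅ + ∑ S ∈ Finset.powersetCard 2 Finset.univ, α S • walsh S := by
      ext v; simp [hF, walsh_empty, Finset.sum_apply]
    rw [this]
    refine add_mem (Submodule.smul_mem _ _ (walsh_mem_walshDegreeLE (by simp)))
      (sum_mem fun S hS => Submodule.smul_mem _ _ (walsh_mem_walshDegreeLE ?_))
    exact (Finset.mem_powersetCard.mp hS).2.le
  have hbool : ∀ v, ∃ m : ℤ, F v = m := by
    intro v
    have h4 : F * F - F ∈ walshDegreeLE ι 4 :=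
      sub_mem (walshDegreeLE_mono (show 2 + 2 ≤ 4 by norm_num) (mul_mem_walshDegreeLE hdeg hdeg))
        (walshDegreeLE_mono (show 2 ≤ 4 by norm_num) hdeg)
    have heven : ∀ w : ι → ZMod 2, Even (hammingNorm w) → (F * F - F) w = 0 := by
      intro w hw
      have hw' : F w = 0 ∨ F w = 1 := by rw [hF]; exact h w hw
      rw [Pi.sub_apply, Pi.mul_apply]
      rcases hw' with hw' | hw' <;> rw [hw'] <;> norm_num
    -- Degree `4` needs `4 + 4 < card ι`, hence `hcard`.
    have hv := eq_zero_of_eq_zero_on_even (by omega) h4 heven v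
    have hv' : F v * (F v - 1) = 0 := by
      rw [Pi.sub_apply, Pi.mul_apply] at hv; linarith
    rcases mul_eq_zero.mp hv' with h | h
    · exact ⟨0, by simpa using h⟩
    · exact ⟨1, by simpa using sub_eq_zero.mp h⟩
  choose m hm using hbool
  have hα : ∀ S ∈ Finset.powersetCard 2 (Finset.univ : Finset ι), ∃ k : ℤ, 4 * α S = k := by
    intro S hS
    obtain ⟨i, j, hij, rfl⟩ := Finset.card_eq_two.mp (Finset.mem_powersetCard.mp hS).2
    -- The second difference of `F` at `0` in directions `i, j` kills every term whose `S` misses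
    -- `i` or `j`, leaving `4 * α {i, j}`.
    refine ⟨m 0 - m (Pi.single i 1) - m (Pi.single j 1) + m (Pi.single i 1 + Pi.single j 1), ?_⟩
    push_cast
    simp only [← hm, hF]
    have hsum : ∑ S ∈ Finset.powersetCard 2 Finset.univ, α S *
        ((1 - walsh S (Pi.single i 1)) * (1 - walsh S (Pi.single j 1))) = 4 * α {i, j} := by
      rw [Finset.sum_eq_single_of_mem _ hS]
      · simp only [walsh_single, Finset.mem_insert, Finset.mem_singleton, true_or, or_true,
          if_true]
        ring
      · intro T hT hne
        by_cases hi : i ∈ T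
        · by_cases hj : j ∈ T
          · exact absurd (Finset.eq_of_subset_of_card_le (s := {i, j}) (t := T)
              (by simp [Finset.insert_subset_iff, hi, hj])
              (by rw [(Finset.mem_powersetCard.mp hT).2, Finset.card_pair hij])).symm hne
          · simp [walsh_single, hj]
        · simp [walsh_single, hi]
    have hexp : ∀ S, α S * ((1 - walsh S (Pi.single i 1)) * (1 - walsh S (Pi.single j 1)))
        = α S * walsh S 0 - α S * walsh S (Pi.single i 1) - α S * walsh S (Pi.single j 1)
          + α S * walsh S (Pi.single i 1 + Pi.single j 1) := by
      intro S; rw [walsh_zero, walsh_add]; ring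
    simp only [hexp, Finset.sum_add_distrib, Finset.sum_sub_distrib] at hsum
    linarith
  choose! k hk using hα
  -- Evaluate at `0`: `F 0 = t + ∑ α S`.
  refine ⟨4 * m 0 - ∑ S ∈ Finset.powersetCard 2 Finset.univ, k S, ?_⟩
  push_cast
  rw [← hm 0, ← Finset.sum_congr rfl hk, ← Finset.mul_sum]
  simp only [hF, walsh_zero, mul_one]
  ring

theorem even_hammingNorm_add (v w : ι → ZMod 2) :
    Even (hammingNorm (v + w)) ↔ (Even (hammingNorm v) ↔ Even (hammingNorm w)) := by
  have h := walsh_add Finset.univ v w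
  simp only [walsh_univ, ← pow_add] at h
  have h' : ∀ n : ℕ, Even n ↔ (-1 : ℝ) ^ n = 1 := fun n => (neg_one_pow_eq_one_iff_even (by norm_num)).symm
  rw [h', h, ← h', Nat.even_add]

end Walsh

/-! ### Equitable partitions of the halved cube. -/

section Main

/-- The indicator function of a cell, extended by zero to the odd words. -/
noncomputable def cellIndicator {n k : ℕ} (C : {x : Fin n → ZMod 2 // Even (hammingNorm x)} → Fin k)
    (j : Fin k) (v : Fin n → ZMod 2) : ℝ :=
  open Classical in if ∃ h : Even (hammingNorm v), C ⟨v, h⟩ = j then 1 else 0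

theorem sum_cellIndicator_neighbours {n k : ℕ}
    {C : {x : Fin n → ZMod 2 // Even (hammingNorm x)} → Fin k} {M : Matrix (Fin k) (Fin k) ℕ}
    (hC : IsEquitablePartition (halvedCube n) C M) (j : Fin k)
    (v : {x : Fin n → ZMod 2 // Even (hammingNorm x)}) :
    ∑ d : Fin n → ZMod 2 with hammingNorm d = 2, cellIndicator C j (v.1 + d) = M (C v) j := by
  classical
  rw [← hC.2 (C v) j v rfl]
  unfold cellIndicator
  rw [Finset.sum_boole, Finset.filter_filter, ← Set.ncard_coe_finset]
  congr 1
  have hinj : Function.Injective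
      fun w : {x : Fin n → ZMod 2 // Even (hammingNorm x)} => v.1 + w.1 :=
    fun x y h => Subtype.ext (add_left_cancel h)
  rw [← Set.ncard_image_of_injective _ hinj]
  congr 1
  ext d
  simp only [Finset.coe_filter, Finset.mem_univ, true_and, Set.mem_ofPred_eq, Set.mem_image]
  have hd : v.1 + (v.1 + d) = d := by rw [← add_assoc, add_self_binary, zero_add]
  have hadj : ∀ w : {x : Fin n → ZMod 2 // Even (hammingNorm x)},
      (halvedCube n).Adj v w ↔ hammingNorm (v.1 + w.1) = 2 := by
    intro w
    have : -v.1 + w.1 = v.1 + w.1 := by ext i; simp [CharTwo.neg_eq]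
    rw [← this, ← hammingDist_eq_hammingNorm]; rfl
  constructor
  · rintro ⟨h2, h, hj⟩
    exact ⟨⟨v.1 + d, h⟩, ⟨(hadj _).mpr (by rw [hd]; exact h2), hj⟩, hd⟩
  · rintro ⟨w, ⟨hw, hj⟩, rfl⟩
    have hw' : v.1 + (v.1 + w.1) = w.1 := by rw [← add_assoc, add_self_binary, zero_add]
    refine ⟨(hadj w).mp hw, ?_⟩
    simp only [hw']
    exact ⟨w.2, hj⟩

theorem cellIndicator_coe {n k : ℕ} (C : {x : Fin n → ZMod 2 // Even (hammingNorm x)} → Fin k)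
    (j : Fin k) (v : {x : Fin n → ZMod 2 // Even (hammingNorm x)}) :
    cellIndicator C j v.1 = if C v = j then 1 else 0 := by
  simp [cellIndicator, v.2]

theorem cellIndicator_of_not_even {n k : ℕ}
    (C : {x : Fin n → ZMod 2 // Even (hammingNorm x)} → Fin k) (j : Fin k) {v : Fin n → ZMod 2}
    (hv : ¬ Even (hammingNorm v)) : cellIndicator C j v = 0 := by
  simp [cellIndicator, hv]

/-- The rows of the quotient matrix sum to the valency. -/
theorem row_sum_of_isEquitablePartition
    {C : {x : Fin 10 → ZMod 2 // Even (hammingNorm x)} → Fin 2} {M : Matrix (Fin 2) (Fin 2) ℕ}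
    (hC : IsEquitablePartition (halvedCube 10) C M) (i : Fin 2) : M i 0 + M i 1 = 45 := by
  obtain ⟨v, rfl⟩ := hC.1 i
  have h0 := sum_cellIndicator_neighbours hC 0 v
  have h1 := sum_cellIndicator_neighbours hC 1 v
  have h2 := sum_walsh_weight_two (∅ : Finset (Fin 10))
  have h3 : ∀ d ∈ Finset.univ.filter (fun d : Fin 10 → ZMod 2 => hammingNorm d = 2),
      cellIndicator C 0 (v.1 + d) + cellIndicator C 1 (v.1 + d) = walsh ∅ d := by
    intro d hd
    have hd2 : hammingNorm d = 2 := by simpa using hd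
    have he : Even (hammingNorm (v.1 + d)) := by
      rw [even_hammingNorm_add, hd2]; simp [v.2]
    rw [cellIndicator_coe C 0 ⟨_, he⟩, cellIndicator_coe C 1 ⟨_, he⟩, walsh_empty]
    generalize C ⟨_, he⟩ = x
    fin_cases x <;> simp
  rw [← Finset.sum_congr rfl h3, Finset.sum_add_distrib, h0, h1] at h2
  norm_num at h2
  exact_mod_cast h2

theorem eight_dvd_of_isEquitablePartition
    {C : {x : Fin 10 → ZMod 2 // Even (hammingNorm x)} → Fin 2} {M : Matrix (Fin 2) (Fin 2) ℕ}
    (hC : IsEquitablePartition (halvedCube 10) C M) (hM : M 0 0 = M 1 0 + 13) :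
    8 ∣ M 1 0 := by
  set g := cellIndicator C 0 with hg
  obtain ⟨c, hc⟩ : ∃ c : ℝ, c = (M 1 0 : ℕ) := ⟨_, rfl⟩
  have hodd : ∀ v, ¬ Even (hammingNorm v) → g v = 0 := fun v hv =>
    cellIndicator_of_not_even C 0 hv
  have hloc : (fun v => ∑ d : Fin 10 → ZMod 2 with hammingNorm d = 2, g (v + d))
      = fun v => 13 * g v + c * (if Even (hammingNorm v) then 1 else 0) := by
    ext v
    by_cases hv : Even (hammingNorm v)
    · rw [sum_cellIndicator_neighbours hC 0 ⟨v, hv⟩, hg, cellIndicator_coe C 0 ⟨v, hv⟩, if_pos hv]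
      generalize C ⟨v, hv⟩ = x
      fin_cases x
      · simp [hM, hc, add_comm]
      · simp [hc]
    · rw [hodd v hv, if_neg hv, Finset.sum_eq_zero]
      · simp
      · intro d hd
        refine hodd _ ?_
        rw [even_hammingNorm_add, (Finset.mem_filter.mp hd).2]
        simp [hv]
  have hT : ∀ S, (((10 - 2 * S.card : ℝ) ^ 2 - 10) / 2 - 13) * walshTransform g S
      = c * walshTransform (fun v => if Even (hammingNorm v) then 1 else 0) S := by
    intro S
    have h := walshTransform_sum_translate g
      (Finset.univ.filter fun d : Fin 10 → ZMod 2 => hammingNorm d = 2) S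
    rw [hloc, sum_walsh_weight_two] at h
    have h' : walshTransform
        (fun v => 13 * g v + c * (if Even (hammingNorm v) then 1 else 0)) S
        = 13 * walshTransform g S
          + c * walshTransform (fun v => if Even (hammingNorm v) then 1 else 0) S := by
      simp only [walshTransform, Finset.mul_sum, ← Finset.sum_add_distrib]
      exact Finset.sum_congr rfl fun v _ => by ring
    rw [h'] at h
    simp only [Fintype.card_fin, Nat.cast_ofNat] at h
    linarith
  -- At `∅` the relation reads `(45 - 13) * walshTransform g ∅ = 512 * c`.
  have h0 : walshTransform g ∅ = 16 * c := by
    have h := hT ∅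
    rw [sum_even_walsh_empty] at h
    norm_num at h
    linarith
  have hz : ∀ S : Finset (Fin 10), S.card ≠ 0 → S.card ≠ 2 → S.card ≠ 8 → S.card ≠ 10 →
      walshTransform g S = 0 := by
    intro S h0 h2 h8 h10
    have h := hT S
    rw [sum_even_walsh_eq_zero (by rintro rfl; simp at h0) (by rintro rfl; simp at h10),
      mul_zero] at h
    refine (mul_eq_zero.mp h).resolve_left fun h => ?_
    -- The eigenvalue at degree `k` minus `13` is `2(k - 2)(k - 8)`.
    have h' : ((S.card : ℝ) - 2) * (S.card - 8) = 0 := by linarith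
    rcases mul_eq_zero.mp h' with h | h
    · exact h2 (by exact_mod_cast sub_eq_zero.mp h)
    · exact h8 (by exact_mod_cast sub_eq_zero.mp h)
  have hinv : ∀ v, Even (hammingNorm v) → c / 32 +
      ∑ S ∈ Finset.powersetCard 2 Finset.univ, walshTransform g S / 512 * walsh S v = g v := by
    intro v hv
    -- On even words, degrees `8` and `10` duplicate `2` and `0`, so inversion halves `1024` to
    -- `512`.
    have hcompl : ∀ S, walshTransform g Sᶜ * walsh Sᶜ v = walshTransform g S * walsh S v := by
      intro S
      rw [walshTransform_compl hodd, walsh_compl, walsh_univ, hv.neg_one_pow, one_mul]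
    have h := walsh_inversion g v
    have hsplit : ∑ S, walshTransform g S * walsh S v
        = ∑ k ∈ Finset.range 11, ∑ S ∈ Finset.powersetCard k Finset.univ,
            walshTransform g S * walsh S v := by
      rw [← Finset.powerset_univ, Finset.sum_powerset]; simp
    have hzero : ∀ k, k ≠ 0 → k ≠ 2 → k ≠ 8 → k ≠ 10 →
        ∑ S ∈ Finset.powersetCard k (Finset.univ : Finset (Fin 10)),
          walshTransform g S * walsh S v = 0 := by
      intro k h0 h2 h8 h10
      refine Finset.sum_eq_zero fun S hS => ?_
      obtain rfl := (Finset.mem_powersetCard.mp hS).2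
      rw [hz S h0 h2 h8 h10, zero_mul]
    have hsymm : ∀ k ≤ 10, ∑ S ∈ Finset.powersetCard (10 - k) (Finset.univ : Finset (Fin 10)),
          walshTransform g S * walsh S v
        = ∑ S ∈ Finset.powersetCard k Finset.univ, walshTransform g S * walsh S v := by
      intro k hk
      refine Finset.sum_bij' (fun S _ => Sᶜ) (fun S _ => Sᶜ) ?_ ?_ (by simp) (by simp) ?_
      · intro S hS
        have := (Finset.mem_powersetCard.mp hS).2
        simp [Finset.mem_powersetCard, Finset.card_compl]; omega
      · intro S hS
        have := (Finset.mem_powersetCard.mp hS).2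
        simp [Finset.mem_powersetCard, Finset.card_compl]; omega
      · intro S _; exact (hcompl S).symm
    rw [hsplit] at h
    have e8 := hsymm 2 (by norm_num)
    have e10 := hsymm 0 (by norm_num)
    simp only [Finset.sum_range_succ, Finset.sum_range_zero] at h
    norm_num [hzero] at h e8 e10
    rw [e8, e10, walsh_empty, h0] at h
    have hdiv : ∑ S ∈ Finset.powersetCard 2 Finset.univ, walshTransform g S / 512 * walsh S v
        = (∑ S ∈ Finset.powersetCard 2 Finset.univ, walshTransform g S * walsh S v) / 512 := by
      rw [Finset.sum_div]; exact Finset.sum_congr rfl fun S _ => by ring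
    rw [hdiv]
    linarith
  obtain ⟨m, hm⟩ := exists_int_eq_four_mul_mean (by simp) (c / 32)
    (fun S : Finset (Fin 10) => walshTransform g S / 512) (fun v hv => by
      rw [hinv v hv, hg, cellIndicator_coe C 0 ⟨v, hv⟩]
      split_ifs <;> simp)
  have h8 : (M 1 0 : ℤ) = 8 * m := by
    have : (M 1 0 : ℝ) = 8 * m := by rw [← hc]; linarith
    exact_mod_cast this
  omega

end Main

theorem mainTheorem9 (a b c d : ℕ) (ha : a ∈ Set.Icc 14 28 \ {21})
    (heig : Module.End.HasEigenvalue
      (Matrix.toLin' ((!![a, b; c, d] : Matrix (Fin 2) (Fin 2) ℕ).map (Nat.cast : ℕ → ℝ))) 13) :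
    ¬ ∃ C : {x : Fin 10 → ZMod 2 // Even (hammingNorm x)} → Fin 2,
      IsEquitablePartition (halvedCube 10) C !![a, b; c, d] := by
  rintro ⟨C, hC⟩
  have hab : a + b = 45 := row_sum_of_isEquitablePartition hC 0
  have hcd : c + d = 45 := row_sum_of_isEquitablePartition hC 1
  have hac : a = c + 13 := by
    obtain ⟨x, hx⟩ := heig.exists_hasEigenvector
    have hx0 := hx.2
    have hx1 := hx.apply_eq_smul
    have e0 := congrFun hx1 0
    have e1 := congrFun hx1 1
    simp [Matrix.mulVec, dotProduct, Fin.sum_univ_two] at e0 e1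
    have hb : (b : ℝ) = 45 - a := by rw [eq_sub_iff_add_eq, add_comm]; exact_mod_cast hab
    have hd : (d : ℝ) = 45 - c := by rw [eq_sub_iff_add_eq, add_comm]; exact_mod_cast hcd
    rw [hb] at e0
    rw [hd] at e1
    -- Cramer's rule: the matrix minus `13` has determinant `32(a - c - 13)`, which must vanish as
    -- `x ≠ 0`.
    have k0 : x 0 * ((a : ℝ) - c - 13) = 0 := by
      linear_combination (32 - c : ℝ) / 32 * e0 - (45 - a : ℝ) / 32 * e1
    have k1 : x 1 * ((a : ℝ) - c - 13) = 0 := by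
      linear_combination (a - 13 : ℝ) / 32 * e1 - (c : ℝ) / 32 * e0
    have k : (a : ℝ) - c - 13 = 0 := by
      by_contra hne
      refine hx0 (funext fun i => ?_)
      fin_cases i
      · exact (mul_eq_zero.mp k0).resolve_right hne
      · exact (mul_eq_zero.mp k1).resolve_right hne
    have : (a : ℝ) = c + 13 := by linarith
    exact_mod_cast this
  have h8 : 8 ∣ c := eight_dvd_of_isEquitablePartition hC hac
  obtain ⟨⟨h1, h2⟩, h3⟩ := ha
  simp only [Set.mem_singleton_iff] at h3
  omega
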